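/- Let $p\equiv 1\pmod 4$ be a prime and let $r\geq 1$ be an integer. Write $(a)_k=a(a+1)\cdots(a+k-1)$ for the rising factorial, with $(a)_0=1$, and let $\Gamma_p:\mathbb{Z}_p\to\mathbb{Z}_p$ be Morita's $p$-adic Gamma function, defined by $\Gamma_p(0)=1$, $\Gamma_p(n)=(-1)^n\prod_{0<k<n,\ p\nmid k}k$ for integers $n\geq 1$, and $\Gamma_p(x)=\lim_{n\to x}\Gamma_p(n)$ for $x\in\mathbb{Z}_p$, where $n$ runs through the positive integers tending $p$-adically to $x$. Then $$\sum_{k=0}^{(p^r-1)/2}\frac{(\frac12)_k^3}{k!^3}\equiv-\Gamma_p(\tfrac14)^4\sum_{k=0}^{(p^{r-1}-1)/2}\frac{(\frac12)_k^3}{k!^3}\pmod{p^{r+1}}$$ and $$\sum_{k=0}^{p^r-1}\frac{(\frac12)_k^3}{k!^3}\equiv-\Gamma_p(\tfrac14)^4\sum_{k=0}^{p^{r-1}-1}\frac{(\frac12)_k^3}{k!^3}\pmod{p^{r+1}},$$ where $x\equiv y\pmod{p^{m}}$ means $x-y\in p^{m}\mathbb{Z}_p$. -/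

import Mathlib

open Filter Topology

/-- The values of Morita's `p`-adic Gamma function at the natural numbers:
`Γ_p(n) = (-1)^n ∏_{0 < k < n, p ∤ k} k`, and `Γ_p(0) = 1` (the empty product). -/
noncomputable def padicGammaNat (p : ℕ) [Fact p.Prime] (n : ℕ) : ℤ_[p] :=
  (-1) ^ n * ∏ k ∈ (Finset.Ioo 0 n).filter (fun k => ¬ p ∣ k), (k : ℤ_[p])

/-- Morita's `p`-adic Gamma function on `ℤ_[p]`, for an odd prime `p`: the limit of `Γ_p(n)` as the
natural number `n` tends `p`-adically to `x`. The limit exists by `tendsto_padicGamma`. -/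
noncomputable def padicGamma (p : ℕ) [Fact p.Prime] (x : ℤ_[p]) : ℤ_[p] :=
  limUnder (comap (Nat.cast : ℕ → ℤ_[p]) (𝓝 x)) (padicGammaNat p)

/-- The sum `∑_{k=0}^{N} (1/2)_k^3 / k!^3`, where `(a)_k = a (a + 1) ⋯ (a + k - 1)`. -/
noncomputable def halfCubeSum (N : ℕ) : ℚ :=
  ∑ k ∈ Finset.range (N + 1),
    (ascPochhammer ℚ k).eval (1 / 2) ^ 3 / (Nat.factorial k : ℚ) ^ 3

/-- Congruence of `p`-adic numbers modulo `p ^ n`: the difference lies in `p ^ n ℤ_p`. -/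
def PadicCongr (p : ℕ) [Fact p.Prime] (n : ℕ) (x y : ℚ_[p]) : Prop :=
  ∃ c : ℤ_[p], x - y = (p : ℚ_[p]) ^ n * (c : ℚ_[p])

/-- For odd `p`, the element `1 / 4` of `ℤ_[p]` is an inverse of `4`. -/
theorem four_mul_padicInv_four (p : ℕ) [Fact p.Prime] (hp : p ≠ 2) :
    (4 : ℤ_[p]) * PadicInt.inv 4 = 1 := by
  have h : ‖((4 : ℕ) : ℤ_[p])‖ = 1 := by
    rw [PadicInt.norm_natCast_eq_one_iff]
    have : p.Coprime 2 := (Nat.coprime_primes Fact.out Nat.prime_two).2 hp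
    exact Nat.Coprime.pow_right 2 this
  exact PadicInt.mul_inv (by exact_mod_cast h)

theorem padicGammaNat_succ (p : ℕ) [Fact p.Prime] (n : ℕ) :
    padicGammaNat p (n + 1) = -(if p ∣ n then 1 else (n : ℤ_[p])) * padicGammaNat p n := by
  rcases Nat.eq_zero_or_pos n with rfl | hn
  · have : Finset.Ioo 0 1 = (∅ : Finset ℕ) := by decide
    simp [padicGammaNat, this]
  · have : Finset.Ioo 0 (n + 1) = insert n (Finset.Ioo 0 n) := by ext; simp; omega
    unfold padicGammaNat
    rw [this, Finset.filter_insert]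
    by_cases h : p ∣ n
    · simp only [h, not_true_eq_false, if_true, if_false]; ring
    · simp only [h, not_false_eq_true, if_true, if_false]
      rw [Finset.prod_insert (by simp)]; ring

theorem prod_units_zmod_prime_pow (p : ℕ) [Fact p.Prime] (hp : p ≠ 2) (m : ℕ) :
    ∏ u : (ZMod (p ^ (m + 1)))ˣ, u = -1 := by
  classical
  have hP : p.Prime := Fact.out
  have hodd : 2 < p ^ (m + 1) :=
    lt_of_lt_of_le (lt_of_le_of_ne hP.two_le hp.symm) (Nat.le_self_pow (by omega) p)
  have : Fact (2 < p ^ (m + 1)) := ⟨hodd⟩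
  have : IsCyclic (ZMod (p ^ (m + 1)))ˣ := ZMod.isCyclic_units_of_prime_pow p hP hp _
  have hne : (1 : (ZMod (p ^ (m + 1)))ˣ) ≠ -1 := by
    intro h
    have h' := congrArg Units.val h
    simp only [Units.val_one, Units.val_neg] at h'
    exact ZMod.neg_one_ne_one h'.symm
  have hsq : ∀ x : (ZMod (p ^ (m + 1)))ˣ, x ^ 2 = 1 → x = 1 ∨ x = -1 := by
    intro x hx
    by_contra! hcon
    have hsub : ({1, -1, x} : Finset (ZMod (p ^ (m + 1)))ˣ) ⊆
        Finset.univ.filter (fun a => a ^ 2 = 1) := by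
      intro y hy
      simp only [Finset.mem_insert, Finset.mem_singleton] at hy
      rcases hy with rfl | rfl | rfl <;> simp [hx]
    have hle := (Finset.card_le_card hsub).trans
      (IsCyclic.card_pow_eq_one_le (n := 2) two_pos)
    rw [Finset.card_eq_three.2 ⟨1, -1, x, hne, hcon.1.symm, hcon.2.symm, rfl⟩] at hle
    omega
  have key : (∏ x ∈ (Finset.univ : Finset (ZMod (p ^ (m + 1)))ˣ).erase (-1), x) = 1 := by
    refine Finset.prod_involution (fun x _ => x⁻¹) (by simp) ?_ ?_ (by simp)
    · intro a ha ha1 hinv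
      have : a ^ 2 = 1 := by rw [pow_two]; nth_rewrite 1 [← hinv]; simp
      rcases hsq a this with h | h
      · exact ha1 h
      · simp [h] at ha
    · intro a ha
      simp only [Finset.mem_erase, Finset.mem_univ, and_true] at ha ⊢
      intro h
      exact ha (by rw [← inv_inv a, h]; simp)
  rw [← Finset.mul_prod_erase _ _ (Finset.mem_univ (-1)), key, mul_one]

theorem toZModPow_padicGammaNat_pow (p : ℕ) [Fact p.Prime] (hp : p ≠ 2) (m : ℕ) :
    PadicInt.toZModPow (m + 1) (padicGammaNat p (p ^ (m + 1))) = 1 := by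
  have hP : p.Prime := Fact.out
  have hodd : Odd (p ^ (m + 1)) := (hP.odd_of_ne_two hp).pow
  have : NeZero (p ^ (m + 1)) := ⟨(pow_pos hP.pos _).ne'⟩
  have hprod : ∏ k ∈ (Finset.Ioo 0 (p ^ (m + 1))).filter (fun k => ¬ p ∣ k),
      ((k : ℕ) : ZMod (p ^ (m + 1))) = ∏ u : (ZMod (p ^ (m + 1)))ˣ, (u : ZMod (p ^ (m + 1))) := by
    have hcop : ∀ k : ℕ, ¬ p ∣ k → k.Coprime (p ^ (m + 1)) := fun k hk =>
      (((Nat.Prime.coprime_iff_not_dvd hP).2 hk).symm).pow_right _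
    refine Finset.prod_bij' (fun k hk => ZMod.unitOfCoprime k
        (hcop k (Finset.mem_filter.1 hk).2)) (fun u _ => (u : ZMod (p ^ (m + 1))).val)
      (by simp) ?_ ?_ ?_ ?_
    · intro u _
      have hc := ZMod.val_coe_unit_coprime u
      have hnd : ¬ p ∣ (u : ZMod (p ^ (m + 1))).val := by
        intro hd
        exact (Nat.Prime.coprime_iff_not_dvd hP).1
          (Nat.Coprime.coprime_dvd_left (dvd_pow_self p (Nat.succ_ne_zero m)) hc.symm) hd
      simp only [Finset.mem_filter, Finset.mem_Ioo]
      refine ⟨⟨Nat.pos_of_ne_zero fun h => hnd (h ▸ dvd_zero p), ZMod.val_lt _⟩, hnd⟩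
    · intro k hk
      simp only [Finset.mem_filter, Finset.mem_Ioo] at hk
      simp [ZMod.val_natCast, Nat.mod_eq_of_lt hk.1.2]
    · intro u _
      ext
      simp
    · intro k hk
      simp
  have h1 : ∏ u : (ZMod (p ^ (m + 1)))ˣ, (u : ZMod (p ^ (m + 1))) = -1 := by
    have h := congrArg (Units.val) (prod_units_zmod_prime_pow p hp m)
    simpa [Units.coe_prod] using h
  unfold padicGammaNat
  rw [map_mul, map_pow, map_neg, map_one, map_prod, hodd.neg_one_pow]
  simp only [map_natCast]
  rw [hprod, h1]
  ring

theorem toZModPow_padicGammaNat_add (p : ℕ) [Fact p.Prime] (hp : p ≠ 2) (m n : ℕ) :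
    PadicInt.toZModPow (m + 1) (padicGammaNat p (n + p ^ (m + 1))) =
      PadicInt.toZModPow (m + 1) (padicGammaNat p n) := by
  induction n with
  | zero => rw [zero_add, toZModPow_padicGammaNat_pow p hp]; simp [padicGammaNat]
  | succ n ih =>
    have hd : p ∣ n + p ^ (m + 1) ↔ p ∣ n :=
      (Nat.dvd_add_left (dvd_pow_self p (Nat.succ_ne_zero m)))
    rw [show n + 1 + p ^ (m + 1) = (n + p ^ (m + 1)) + 1 by ring, padicGammaNat_succ,
      padicGammaNat_succ, map_mul, map_mul, ih]
    congr 1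
    simp only [hd]
    split_ifs
    · rfl
    · rw [map_neg, map_neg, map_natCast, map_natCast, Nat.cast_add, ZMod.natCast_self, add_zero]

theorem toZModPow_padicGammaNat_congr (p : ℕ) [Fact p.Prime] (hp : p ≠ 2) (m a b : ℕ)
    (h : a ≡ b [MOD p ^ (m + 1)]) :
    PadicInt.toZModPow (m + 1) (padicGammaNat p a) =
      PadicInt.toZModPow (m + 1) (padicGammaNat p b) := by
  have key : ∀ r t : ℕ, PadicInt.toZModPow (m + 1) (padicGammaNat p (r + p ^ (m + 1) * t)) =
      PadicInt.toZModPow (m + 1) (padicGammaNat p r) := by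
    intro r t
    induction t with
    | zero => simp
    | succ t ih => rw [Nat.mul_succ, ← add_assoc, toZModPow_padicGammaNat_add p hp, ih]
  rw [← Nat.mod_add_div a (p ^ (m + 1)), ← Nat.mod_add_div b (p ^ (m + 1)), key, key, h]

/-- For odd `p`, the limit defining `padicGamma` exists, along all natural numbers that tend
`p`-adically to `x`. -/
theorem tendsto_padicGamma (p : ℕ) [Fact p.Prime] (hp : p ≠ 2) (x : ℤ_[p]) :
    Tendsto (padicGammaNat p) (comap (Nat.cast : ℕ → ℤ_[p]) (𝓝 x)) (𝓝 (padicGamma p x)) := by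
  have hP : p.Prime := Fact.out
  refine tendsto_nhds_limUnder ?_
  have : (comap (Nat.cast : ℕ → ℤ_[p]) (𝓝 x)).NeBot := by
    rw [comap_neBot_iff]
    intro t ht
    obtain ⟨_, ⟨n, rfl⟩, hn⟩ :=
      (PadicInt.denseRange_natCast (p := p)).inter_nhds_nonempty ht
    exact ⟨n, hn⟩
  have hC : Cauchy (map (padicGammaNat p) (comap (Nat.cast : ℕ → ℤ_[p]) (𝓝 x))) := by
    rw [Metric.cauchy_iff]
    refine ⟨inferInstance, fun ε hε => ?_⟩
    obtain ⟨m, hm⟩ := PadicInt.exists_pow_neg_lt p hε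
    have hm' : (p : ℝ) ^ (-((m + 1 : ℕ) : ℤ)) < ε := by
      refine lt_of_le_of_lt (zpow_le_zpow_right₀ (by exact_mod_cast hP.one_le) ?_) hm
      push_cast; omega
    have hpos : (0 : ℝ) < (p : ℝ) ^ (-((m + 1 : ℕ) : ℤ)) :=
      zpow_pos (by exact_mod_cast hP.pos) _
    refine ⟨padicGammaNat p '' ((Nat.cast : ℕ → ℤ_[p]) ⁻¹'
      Metric.ball x ((p : ℝ) ^ (-((m + 1 : ℕ) : ℤ)))), ?_, ?_⟩
    · exact image_mem_map (preimage_mem_comap (Metric.ball_mem_nhds x hpos))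
    · have hk : ∀ y z : ℤ_[p], ‖y - z‖ ≤ (p : ℝ) ^ (-((m + 1 : ℕ) : ℤ)) ↔
          PadicInt.toZModPow (m + 1) y = PadicInt.toZModPow (m + 1) z := by
        intro y z
        rw [PadicInt.norm_le_pow_iff_mem_span_pow, ← PadicInt.ker_toZModPow, RingHom.mem_ker,
          map_sub, sub_eq_zero]
      rintro _ ⟨a, ha, rfl⟩ _ ⟨b, hb, rfl⟩
      have ha' : ‖(a : ℤ_[p]) - x‖ ≤ (p : ℝ) ^ (-((m + 1 : ℕ) : ℤ)) := by
        rw [← dist_eq_norm]; exact le_of_lt ha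
      have hb' : ‖(b : ℤ_[p]) - x‖ ≤ (p : ℝ) ^ (-((m + 1 : ℕ) : ℤ)) := by
        rw [← dist_eq_norm]; exact le_of_lt hb
      have hab := ((hk _ _).1 ha').trans ((hk _ _).1 hb').symm
      rw [map_natCast, map_natCast, ZMod.natCast_eq_natCast_iff] at hab
      rw [dist_eq_norm]
      exact lt_of_le_of_lt ((hk _ _).2 (toZModPow_padicGammaNat_congr p hp m a b hab)) hm'
  exact CompleteSpace.complete hC

theorem padicGamma_natCast (p : ℕ) [Fact p.Prime] (hp : p ≠ 2) (n : ℕ) :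
    padicGamma p (n : ℤ_[p]) = padicGammaNat p n := by
  have h : Tendsto (padicGammaNat p) (pure n) (𝓝 (padicGamma p n)) :=
    (tendsto_padicGamma p hp n).mono_left (by
      rw [← map_le_iff_le_comap, map_pure]; exact pure_le_nhds _)
  exact (tendsto_nhds_unique h (tendsto_pure_nhds _ _))

/-! Write S_N(Z) for `deformedSum N Z`, so that S_N(0) is the sum to be studied. At Z = (n + 1/2)^2
with n ≤ N the factors become (i - n)(i + n + 1), and S_N is the terminating series 3F2(1/2, -n, n +
1; 1, 1; 1). It is 0 for odd n and ((1/2)_l / l!)^2 for n = 2l (`deformedSum_odd`,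
`deformedSum_even`).

Put M = ⌊N/p⌋ and F(Z) = S_N(p^2 Z) + Γ_p(1/4)^4 S_M(Z); the claim is that F(0) is highly divisible
by p. At the nodes Z = (n + 1/2)^2, n ≤ M, one has p^2 Z = (n' + 1/2)^2 with n' = pn + (p - 1)/2,
which has the parity of n because p ≡ 1 mod 4. For odd n both terms vanish. For even n the ratio of
the two closed forms is -Γ_p(1/4 + t)^2 Γ_p(1/4 - t)^2 with t = p(2n + 1)/4, and evenness in t gives
agreement with -Γ_p(1/4)^4 modulo p^2 (2n + 1) (`padicGamma_sq_mul_congr`). Hence p^2 (2n + 1)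
divides F at node n (`deformedSum_sub_at_node`).

Lagrange interpolation transports this to Z = 0. The weight of node n times 2n + 1 is, up to a unit,
an integer multiple of (2M + 1) binom(2M, M) (`lagrange_weight_odd_squares`), a number divisible by
p^(r-1) for both truncations. The interpolation error is an integral multiple of the product of the
nodes p^2 Z, once N!^2 has cleared denominators, and that product absorbs N!^2 with powers of p to
spare (`prod_nodes_eq`). The total is divisible by p^(r+1). -/

/-! ### The deformed sum and its closed forms at half-integer squares -/

/-- The terminating-type sum `∑_{k ≤ N} (1/2)_k / k!^3 * ∏_{i<k} ((i + 1/2)^2 - Z)`. -/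
noncomputable def deformedSum {K : Type*} [Field K] (N : ℕ) (Z : K) : K :=
  ∑ k ∈ Finset.range (N + 1), (∏ i ∈ Finset.range k, ((1 : K) / 2 + i)) / (k.factorial : K) ^ 3 *
    ∏ i ∈ Finset.range k, (((i : K) + 1 / 2) ^ 2 - Z)

theorem ascPochhammer_eval_eq_prod_range (x : ℚ) (k : ℕ) :
    (ascPochhammer ℚ k).eval x = ∏ i ∈ Finset.range k, (x + i) := by
  induction k with
  | zero => simp
  | succ k ih => rw [ascPochhammer_succ_eval, ih, Finset.prod_range_succ]

theorem halfCubeSum_cast {K : Type*} [Field K] [CharZero K] (N : ℕ) :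
    (halfCubeSum N : K) = deformedSum N 0 := by
  unfold halfCubeSum deformedSum
  push_cast
  refine Finset.sum_congr rfl fun k _ => ?_
  rw [ascPochhammer_eval_eq_prod_range]
  push_cast
  have : ∏ i ∈ Finset.range k, (((i : K) + 1 / 2) ^ 2 - 0)
      = (∏ i ∈ Finset.range k, ((1 : K) / 2 + i)) ^ 2 := by
    rw [← Finset.prod_pow]
    exact Finset.prod_congr rfl fun i _ => by ring
  rw [this]
  ring

theorem deformedSum_eq_of_le {K : Type*} [Field K] (n N : ℕ) (h : n ≤ N) :
    deformedSum N ((n + 1 / 2 : K) ^ 2) = deformedSum n ((n + 1 / 2 : K) ^ 2) := by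
  induction N, h using Nat.le_induction with
  | base => rfl
  | succ N hN ih =>
    rw [deformedSum, Finset.sum_range_succ, Finset.prod_eq_zero
      (f := fun i : ℕ => ((i : K) + 1 / 2) ^ 2 - (n + 1 / 2 : K) ^ 2)
      (Finset.mem_range.2 (by omega : n < N + 1)) (sub_self _), mul_zero, add_zero]
    exact ih

section
variable {K : Type*} [Field K] [CharZero K]

/-- This factorization and the next extract the same product from the parameters x and x + 2, so
that the telescoping below only compares short polynomial cofactors. -/
theorem prod_sq_sub_sq_add_two (x : K) (k : ℕ) :
    ∏ i ∈ Finset.range (k + 2), (((i : K) + 1 / 2) ^ 2 - (x + 1 / 2) ^ 2) =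
      (x + 1) * (x + 2) * (∏ i ∈ Finset.range k, ((i : K) - x) * (i + 3 + x)) *
        ((k - x) * (k + 1 - x)) := by
  induction k with
  | zero =>
    simp only [Finset.prod_range_succ, Finset.prod_range_zero]
    push_cast
    ring
  | succ k ih =>
    rw [Finset.prod_range_succ, ih, Finset.prod_range_succ]
    push_cast
    ring

theorem prod_sq_sub_sq_shift (x : K) (k : ℕ) :
    ∏ i ∈ Finset.range (k + 2), (((i : K) + 1 / 2) ^ 2 - (x + 2 + 1 / 2) ^ 2) =
      (x + 1) * (x + 2) * (∏ i ∈ Finset.range k, ((i : K) - x) * (i + 3 + x)) *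
        ((x + k + 3) * (x + k + 4)) := by
  induction k with
  | zero =>
    simp only [Finset.prod_range_succ, Finset.prod_range_zero]
    push_cast
    ring
  | succ k ih =>
    rw [Finset.prod_range_succ, ih, Finset.prod_range_succ]
    push_cast
    ring

/-- Zeilberger's recurrence in n -> n + 2 for the 3F2, kept for partial sums and arbitrary x: the
right-hand side is the boundary term of the certificate. It vanishes when x is a natural number
below k, through the factor i - x. -/
theorem deformedSum_telescope (x : K) (k : ℕ) :
    (x + 2) ^ 2 * deformedSum (k + 1) ((x + 2 + 1 / 2) ^ 2) -
      (x + 1) ^ 2 * deformedSum (k + 1) ((x + 1 / 2) ^ 2) =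
    -2 * (2 * x + 3) * ((k : K) + 2) ^ 3 *
      ((∏ i ∈ Finset.range (k + 2), ((1 : K) / 2 + i)) / ((k + 2).factorial : K) ^ 3) *
      ((x + 1) * (x + 2) * (∏ i ∈ Finset.range k, ((i : K) - x) * (i + 3 + x))) := by
  induction k with
  | zero =>
    simp only [deformedSum, Finset.sum_range_succ, Finset.prod_range_succ, Finset.prod_range_zero,
      Finset.sum_range_zero, Nat.factorial]
    push_cast
    field_simp
    ring
  | succ k ih =>
    have hs : ∀ Z : K, deformedSum (k + 1 + 1) Z = deformedSum (k + 1) Z +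
        (∏ i ∈ Finset.range (k + 2), ((1 : K) / 2 + i)) / ((k + 2).factorial : K) ^ 3 *
        ∏ i ∈ Finset.range (k + 2), (((i : K) + 1 / 2) ^ 2 - Z) := fun Z => by
      rw [deformedSum, Finset.sum_range_succ]; rfl
    have hk : ((k : K) + 3) ≠ 0 := by exact_mod_cast (by omega : k + 3 ≠ 0)
    have hf : ((k + 2).factorial : K) ≠ 0 := by exact_mod_cast Nat.factorial_ne_zero _
    have hfac : ((k + 1 + 2).factorial : K) = ((k : K) + 3) * ((k + 2).factorial : K) := by
      rw [show k + 1 + 2 = (k + 2) + 1 by ring, Nat.factorial_succ]; push_cast; ring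
    rw [hs, hs, prod_sq_sub_sq_shift, prod_sq_sub_sq_add_two, hfac,
      show k + 1 + 2 = (k + 2) + 1 by ring, Finset.prod_range_succ (n := k + 2),
      Finset.prod_range_succ (n := k)]
    have hsplit : ∀ a b c d e f : K, a * (b + c) - d * (e + f) = a * b - d * e + (a * c - d * f) :=
      fun a b c d e f => by ring
    rw [hsplit, ih]
    generalize (∏ i ∈ Finset.range (k + 2), ((1 : K) / 2 + i)) = h
    generalize (∏ i ∈ Finset.range k, ((i : K) - x) * (i + 3 + x)) = A
    generalize ((k + 2).factorial : K) = f at *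
    push_cast
    field_simp
    ring

theorem deformedSum_recurrence (n N : ℕ) (h : n + 2 ≤ N) :
    ((n : K) + 2) ^ 2 * deformedSum N ((n + 2 + 1 / 2 : K) ^ 2) =
      ((n : K) + 1) ^ 2 * deformedSum N ((n + 1 / 2 : K) ^ 2) := by
  obtain ⟨k, rfl⟩ : ∃ k, N = k + 1 := ⟨N - 1, by omega⟩
  have hz : ∏ i ∈ Finset.range k, ((i : K) - n) * (i + 3 + n) = 0 :=
    Finset.prod_eq_zero (Finset.mem_range.2 (by omega : n < k)) (by simp)
  have := deformedSum_telescope (n : K) k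
  rw [hz, mul_zero, mul_zero, sub_eq_zero] at this
  exact this

theorem deformedSum_odd (j N : ℕ) (h : 2 * j + 1 ≤ N) :
    deformedSum N ((((2 * j + 1 : ℕ) : K) + 1 / 2) ^ 2) = 0 := by
  induction j with
  | zero =>
    rw [deformedSum_eq_of_le _ _ h]
    simp only [deformedSum, Finset.sum_range_succ, Finset.prod_range_succ, Finset.prod_range_zero,
      Finset.sum_range_zero, Nat.factorial]
    push_cast
    norm_num
  | succ j ih =>
    have h1 := deformedSum_recurrence (K := K) (2 * j + 1) N (by omega)
    rw [ih (by omega), mul_zero] at h1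
    have h2 : (((2 * j + 1 : ℕ) : K) + 2) ^ 2 ≠ 0 :=
      pow_ne_zero _ (by exact_mod_cast (by omega : 2 * j + 1 + 2 ≠ 0))
    rw [← (mul_eq_zero.1 h1).resolve_left h2]
    push_cast
    ring_nf

theorem deformedSum_even (j N : ℕ) (h : 2 * j ≤ N) :
    deformedSum N ((((2 * j : ℕ) : K) + 1 / 2) ^ 2) =
      ((∏ i ∈ Finset.range j, ((1 : K) / 2 + i)) / (j.factorial : K)) ^ 2 := by
  induction j with
  | zero =>
    rw [deformedSum_eq_of_le _ _ h]
    simp [deformedSum]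
  | succ j ih =>
    have h1 := deformedSum_recurrence (K := K) (2 * j) N (by omega)
    rw [ih (by omega)] at h1
    have h3 : ((j : K) + 1) ≠ 0 := by exact_mod_cast (by omega : j + 1 ≠ 0)
    have hf : (j.factorial : K) ≠ 0 := by exact_mod_cast Nat.factorial_ne_zero _
    have h2 : (((2 * j : ℕ) : K) + 2) ^ 2 ≠ 0 :=
      pow_ne_zero _ (by exact_mod_cast (by omega : 2 * j + 2 ≠ 0))
    have e : ((((2 * (j + 1) : ℕ) : K) + 1 / 2)) = ((2 * j : ℕ) : K) + 2 + 1 / 2 := by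
      push_cast; ring
    rw [e]
    refine mul_left_cancel₀ h2 (h1.trans ?_)
    rw [Finset.prod_range_succ, Nat.factorial_succ]
    push_cast
    field_simp
    ring

end

/-! ### Functional equation, reflection and local evenness of the p-adic Gamma function -/

section PadicGamma

variable {p : ℕ} [Fact p.Prime]

theorem toZModPow_eq_toZModPow_iff (n : ℕ) (x y : ℤ_[p]) :
    PadicInt.toZModPow n x = PadicInt.toZModPow n y ↔ (p : ℤ_[p]) ^ n ∣ x - y := by
  rw [← Ideal.mem_span_singleton, ← PadicInt.ker_toZModPow, RingHom.mem_ker, map_sub, sub_eq_zero]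

theorem PadicInt.eq_of_forall_pow_succ_dvd {x y : ℤ_[p]}
    (h : ∀ n : ℕ, (p : ℤ_[p]) ^ (n + 1) ∣ x - y) : x = y :=
  PadicInt.ext_of_toZModPow.1 fun n =>
    (toZModPow_eq_toZModPow_iff n x y).2 ((pow_dvd_pow _ n.le_succ).trans (h n))

/-- A single natural number approximates x and the Gamma value at once, which reduces identities and
congruences for `padicGamma` to `padicGammaNat`. -/
theorem exists_natCast_padicGamma (hp : p ≠ 2) (n : ℕ) (x : ℤ_[p]) :
    ∃ a : ℕ, (p : ℤ_[p]) ^ n ∣ x - a ∧ (p : ℤ_[p]) ^ n ∣ padicGamma p x - padicGammaNat p a := by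
  have hne : (comap (Nat.cast : ℕ → ℤ_[p]) (𝓝 x)).NeBot := by
    rw [comap_neBot_iff]
    intro t ht
    obtain ⟨_, ⟨n, rfl⟩, hn⟩ := (PadicInt.denseRange_natCast (p := p)).inter_nhds_nonempty ht
    exact ⟨n, hn⟩
  have hpos : (0 : ℝ) < (p : ℝ) ^ (-(n : ℤ)) :=
    zpow_pos (by exact_mod_cast (Fact.out : p.Prime).pos) _
  have hball : ∀ y : ℤ_[p], ∀ᶠ z in 𝓝 y, (p : ℤ_[p]) ^ n ∣ y - z := fun y => by
    filter_upwards [Metric.ball_mem_nhds y hpos] with z hz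
    rw [← Ideal.mem_span_singleton, ← PadicInt.norm_le_pow_iff_mem_span_pow, ← dist_eq_norm,
      dist_comm]
    exact le_of_lt hz
  exact ((tendsto_comap.eventually (hball x)).and
    ((tendsto_padicGamma p hp x).eventually (hball _))).exists

theorem padicGamma_congr (hp : p ≠ 2) (n : ℕ) {x y : ℤ_[p]} (h : (p : ℤ_[p]) ^ n ∣ x - y) :
    (p : ℤ_[p]) ^ n ∣ padicGamma p x - padicGamma p y := by
  rcases n with _ | n
  · simp
  obtain ⟨a, ha, ha'⟩ := exists_natCast_padicGamma hp (n + 1) x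
  obtain ⟨b, hb, hb'⟩ := exists_natCast_padicGamma hp (n + 1) y
  rw [← toZModPow_eq_toZModPow_iff] at *
  rw [ha', hb']
  refine toZModPow_padicGammaNat_congr p hp n a b ?_
  rw [← ZMod.natCast_eq_natCast_iff, ← map_natCast (PadicInt.toZModPow (p := p) (n + 1)),
    ← map_natCast (PadicInt.toZModPow (p := p) (n + 1)), ← ha, ← hb, h]

/-- `x` itself for a `p`-adic unit `x`, and `1` otherwise. -/
noncomputable def unitOrOne (p : ℕ) [Fact p.Prime] (x : ℤ_[p]) : ℤ_[p] :=
  open scoped Classical in if (p : ℤ_[p]) ∣ x then 1 else x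

theorem unitOrOne_of_dvd {x : ℤ_[p]} (h : (p : ℤ_[p]) ∣ x) : unitOrOne p x = 1 := if_pos h

theorem unitOrOne_of_not_dvd {x : ℤ_[p]} (h : ¬ (p : ℤ_[p]) ∣ x) : unitOrOne p x = x := if_neg h

theorem unitOrOne_neg_sq (x : ℤ_[p]) : unitOrOne p (-x) ^ 2 = unitOrOne p x ^ 2 := by
  by_cases h : (p : ℤ_[p]) ∣ x
  · rw [unitOrOne_of_dvd h, unitOrOne_of_dvd (dvd_neg.2 h)]
  · rw [unitOrOne_of_not_dvd h, unitOrOne_of_not_dvd (fun h' => h (dvd_neg.1 h')), neg_sq]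

theorem PadicInt.natCast_dvd_natCast_iff (n : ℕ) : (p : ℤ_[p]) ∣ (n : ℤ_[p]) ↔ p ∣ n := by
  rw [← PadicInt.norm_lt_one_iff_dvd, PadicInt.norm_natCast_lt_one_iff]

theorem padicGamma_add_one (hp : p ≠ 2) (x : ℤ_[p]) :
    padicGamma p (x + 1) = -unitOrOne p x * padicGamma p x := by
  refine PadicInt.eq_of_forall_pow_succ_dvd fun n => ?_
  obtain ⟨a, ha, ha'⟩ := exists_natCast_padicGamma hp (n + 1) x
  have h1 : (p : ℤ_[p]) ^ (n + 1) ∣ padicGamma p (x + 1) - padicGamma p ((a + 1 : ℕ) : ℤ_[p]) := by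
    refine padicGamma_congr hp _ ?_
    push_cast
    rwa [add_sub_add_right_eq_sub]
  rw [padicGamma_natCast p hp, padicGammaNat_succ] at h1
  have hpa : (p : ℤ_[p]) ∣ x - a := (dvd_pow_self _ n.succ_ne_zero).trans ha
  have hiff : (p : ℤ_[p]) ∣ x ↔ p ∣ a := by
    rw [← PadicInt.natCast_dvd_natCast_iff]
    exact dvd_iff_dvd_of_dvd_sub hpa
  rw [← toZModPow_eq_toZModPow_iff] at *
  rw [h1]
  by_cases h : p ∣ a
  · rw [unitOrOne_of_dvd (hiff.2 h), if_pos h, map_mul, map_mul, ha']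
  · rw [unitOrOne_of_not_dvd (fun h' => h (hiff.1 h')), if_neg h, map_mul, map_mul, ha', map_neg,
      map_neg, ha]

theorem padicGamma_add_natCast (hp : p ≠ 2) (x : ℤ_[p]) (k : ℕ) :
    padicGamma p (x + k) =
      (-1) ^ k * (∏ i ∈ Finset.range k, unitOrOne p (x + i)) * padicGamma p x := by
  induction k with
  | zero => simp
  | succ k ih =>
    rw [Nat.cast_succ, ← add_assoc, padicGamma_add_one hp, ih, Finset.prod_range_succ]
    ring

theorem padicGamma_zero (hp : p ≠ 2) : padicGamma p 0 = 1 := by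
  have := padicGamma_natCast p hp 0
  simpa [padicGammaNat] using this

theorem padicGamma_one (hp : p ≠ 2) : padicGamma p 1 = -1 := by
  have := padicGamma_add_one hp (0 : ℤ_[p])
  rwa [unitOrOne_of_dvd (dvd_zero _), padicGamma_zero hp, zero_add, mul_one] at this

/-- Passing from n to n + 1 changes the sign of the product unless p divides n + 1, when the sign
stays. Squaring avoids tracking this. -/
theorem padicGamma_reflection_sq (hp : p ≠ 2) (n : ℕ) :
    (padicGamma p (n + 1) * padicGamma p (-n)) ^ 2 = 1 := by
  induction n with
  | zero => simp [padicGamma_zero hp, padicGamma_one hp]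
  | succ n ih =>
    have h1 := padicGamma_add_one hp ((n : ℤ_[p]) + 1)
    have h2 := padicGamma_add_one hp (-((n : ℤ_[p]) + 1))
    rw [neg_add_rev, neg_add_cancel_comm, ← neg_add_rev] at h2
    rw [h2] at ih
    push_cast
    rw [h1]
    have h3 := unitOrOne_neg_sq ((n : ℤ_[p]) + 1)
    linear_combination ih - (padicGamma p (n + 1) * padicGamma p (-(n + 1))) ^ 2 * h3

theorem padicGamma_reflection_of_lt (hp : p ≠ 2) (n : ℕ) (hn : n < p) :
    padicGamma p (n + 1) * padicGamma p (-n) = (-1) ^ (n + 1) := by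
  induction n with
  | zero => simp [padicGamma_zero hp, padicGamma_one hp]
  | succ n ih =>
    have h1 := padicGamma_add_one hp ((n : ℤ_[p]) + 1)
    have h2 := padicGamma_add_one hp (-((n : ℤ_[p]) + 1))
    rw [neg_add_rev, neg_add_cancel_comm, ← neg_add_rev] at h2
    have hnd : ¬ (p : ℤ_[p]) ∣ (n : ℤ_[p]) + 1 := fun h => by
      have : (p : ℤ_[p]) ∣ ((n + 1 : ℕ) : ℤ_[p]) := by exact_mod_cast h
      rw [PadicInt.natCast_dvd_natCast_iff] at this
      exact absurd (Nat.le_of_dvd n.succ_pos this) (by omega)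
    rw [unitOrOne_of_not_dvd hnd] at h1
    rw [unitOrOne_of_not_dvd (fun h => hnd (dvd_neg.1 h))] at h2
    have ih' := ih (by omega)
    rw [h2] at ih'
    push_cast
    rw [h1, pow_succ, ← ih']
    ring

/-- If p^M = 2n + 1, then n + 1 and -n are both congruent to 1/2 modulo p^M, so reflection gives
Γ_p(1/2)^4 = 1 in the limit. The sign of the square is read off modulo p at n = (p - 1)/2, which is
even since p ≡ 1 mod 4. -/
theorem padicGamma_half_sq (hp : p % 4 = 1) (h : ℤ_[p]) (hh : 2 * h = 1) :
    padicGamma p h ^ 2 = -1 := by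
  have hp2 : p ≠ 2 := by omega
  have hP : p.Prime := Fact.out
  have key : ∀ M n : ℕ, p ^ M = 2 * n + 1 →
      (p : ℤ_[p]) ^ M ∣ padicGamma p h ^ 2 - padicGamma p (n + 1) * padicGamma p (-n) := by
    intro M n hn
    have hn' : (p : ℤ_[p]) ^ M = 2 * n + 1 := by exact_mod_cast hn
    have e1 : (p : ℤ_[p]) ^ M ∣ padicGamma p h - padicGamma p (n + 1) := by
      refine padicGamma_congr hp2 _ ⟨-h, ?_⟩
      rw [hn']; linear_combination (1 + (n : ℤ_[p])) * hh
    have e2 : (p : ℤ_[p]) ^ M ∣ padicGamma p h - padicGamma p (-n) := by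
      refine padicGamma_congr hp2 _ ⟨h, ?_⟩
      rw [hn']; linear_combination -(n : ℤ_[p]) * hh
    rw [← toZModPow_eq_toZModPow_iff] at *
    rw [map_mul, ← e1, ← e2, map_pow, sq]
  have h4 : padicGamma p h ^ 4 = 1 := by
    refine PadicInt.eq_of_forall_pow_succ_dvd fun M => ?_
    obtain ⟨n, hn⟩ := (hP.odd_of_ne_two hp2).pow (n := M + 1)
    have := key (M + 1) n hn
    have h1 := padicGamma_reflection_sq hp2 n
    rw [← h1, show padicGamma p h ^ 4 = (padicGamma p h ^ 2) ^ 2 by ring]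
    exact this.trans (sub_dvd_pow_sub_pow _ _ 2)
  have hmod : (p : ℤ_[p]) ∣ padicGamma p h ^ 2 + 1 := by
    have := key 1 ((p - 1) / 2) (by rw [pow_one]; omega)
    rw [padicGamma_reflection_of_lt hp2 _ (by omega),
      Odd.neg_one_pow ⟨(p - 1) / 4, by omega⟩, pow_one, sub_neg_eq_add] at this
    exact this
  have hfac : (padicGamma p h ^ 2 - 1) * (padicGamma p h ^ 2 + 1) = 0 := by
    linear_combination h4
  rcases mul_eq_zero.1 hfac with h1 | h1
  · exfalso
    rw [sub_eq_zero.1 h1] at hmod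
    have : (p : ℤ_[p]) ∣ ((2 : ℕ) : ℤ_[p]) := by
      convert hmod using 1; norm_num
    rw [PadicInt.natCast_dvd_natCast_iff] at this
    exact hp2 ((Nat.prime_dvd_prime_iff_eq hP Nat.prime_two).1 this)
  · exact eq_neg_of_add_eq_zero_left h1

theorem PadicInt.dvd_sub_zmodRepr (x : ℤ_[p]) : (p : ℤ_[p]) ∣ x - x.zmodRepr := by
  rw [← Ideal.mem_span_singleton, ← PadicInt.maximalIdeal_eq_span_p]
  exact x.sub_zmodRepr_mem

theorem PadicInt.zmodRepr_eq_of_dvd {x : ℤ_[p]} {n : ℕ} (hn : n < p)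
    (h : (p : ℤ_[p]) ∣ x - n) : x.zmodRepr = n :=
  x.zmodRepr_unique n hn (by
    rwa [PadicInt.maximalIdeal_eq_span_p, Ideal.mem_span_singleton])

/-- The involution sends i to the residue i' with y + i' ≡ -(y + i) mod p. Pairing opposite residues
is what gains a power of p in the next lemma. -/
theorem prod_unitOrOne_sq (y : ℤ_[p]) :
    (∏ i ∈ Finset.range p, unitOrOne p (y + i)) ^ 2 =
      ∏ i ∈ Finset.range p, unitOrOne p (y + i) *
        unitOrOne p (y + (-(2 * y + i)).zmodRepr) := by
  have hinv : ∀ i ∈ Finset.range p,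
      (-(2 * y + ((-(2 * y + (i : ℤ_[p]))).zmodRepr : ℤ_[p]))).zmodRepr = i := fun i hi => by
    refine PadicInt.zmodRepr_eq_of_dvd (Finset.mem_range.1 hi) ?_
    have := PadicInt.dvd_sub_zmodRepr (-(2 * y + (i : ℤ_[p])))
    convert this using 1
    ring
  rw [Finset.prod_mul_distrib, sq]
  congr 1
  refine Finset.prod_nbij' (fun i => (-(2 * y + (i : ℤ_[p]))).zmodRepr)
    (fun i => (-(2 * y + (i : ℤ_[p]))).zmodRepr) ?_ ?_ hinv hinv ?_
  · exact fun i _ => Finset.mem_range.2 (PadicInt.zmodRepr_lt_p _)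
  · exact fun i _ => Finset.mem_range.2 (PadicInt.zmodRepr_lt_p _)
  · intro i hi
    rw [hinv i hi]

/-- For paired units, (y + t + i)(y + t + i') - (y + i)(y + i') = t((y + i) + (y + i') + t), and the
bracket is divisible by p. Thus the first-order term in t disappears modulo p^(s+1). -/
theorem prod_unitOrOne_sq_congr {s : ℕ} (hs : 1 ≤ s) (y t : ℤ_[p]) (ht : (p : ℤ_[p]) ^ s ∣ t) :
    (p : ℤ_[p]) ^ (s + 1) ∣ (∏ i ∈ Finset.range p, unitOrOne p (y + t + i)) ^ 2 -
      (∏ i ∈ Finset.range p, unitOrOne p (y + i)) ^ 2 := by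
  have hpt : (p : ℤ_[p]) ∣ t := (dvd_pow_self _ (by omega)).trans ht
  have hrepr : ∀ i : ℕ, (-(2 * (y + t) + (i : ℤ_[p]))).zmodRepr =
      (-(2 * y + (i : ℤ_[p]))).zmodRepr := fun i => by
    refine PadicInt.zmodRepr_eq_of_dvd (PadicInt.zmodRepr_lt_p _) ?_
    have h1 := PadicInt.dvd_sub_zmodRepr (-(2 * y + (i : ℤ_[p])))
    convert dvd_sub h1 (hpt.mul_left 2) using 1
    ring
  rw [prod_unitOrOne_sq, prod_unitOrOne_sq, ← toZModPow_eq_toZModPow_iff, map_prod, map_prod]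
  refine Finset.prod_congr rfl fun i _ => ?_
  rw [hrepr, toZModPow_eq_toZModPow_iff]
  generalize hj : (-(2 * y + (i : ℤ_[p]))).zmodRepr = j
  have hij : (p : ℤ_[p]) ∣ (y + i) + (y + j) := by
    rw [← dvd_neg]
    convert PadicInt.dvd_sub_zmodRepr (-(2 * y + (i : ℤ_[p]))) using 1
    rw [hj]; ring
  by_cases h : (p : ℤ_[p]) ∣ y + i
  · have h' : (p : ℤ_[p]) ∣ y + j := (dvd_add_right h).1 hij
    rw [unitOrOne_of_dvd h, unitOrOne_of_dvd h', unitOrOne_of_dvd, unitOrOne_of_dvd, sub_self]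
    · exact dvd_zero _
    · rw [add_right_comm]; exact dvd_add h' hpt
    · rw [add_right_comm]; exact dvd_add h hpt
  · have h' : ¬ (p : ℤ_[p]) ∣ y + j := fun h' => h ((dvd_add_left h').1 hij)
    rw [unitOrOne_of_not_dvd h, unitOrOne_of_not_dvd h', unitOrOne_of_not_dvd,
      unitOrOne_of_not_dvd]
    · rw [pow_succ, show (y + t + i) * (y + t + j) - (y + i) * (y + j) =
        t * (((y + i) + (y + j)) + t) by ring]
      exact mul_dvd_mul ht (dvd_add hij hpt)
    · rw [add_right_comm, dvd_add_left hpt]; exact h'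
    · rw [add_right_comm, dvd_add_left hpt]; exact h

/-- A shift by p multiplies Γ_p^2 by the squared product of the preceding lemma, whose value is
insensitive to t. The cross-multiplied form says that Γ_p(y + t)^2 / Γ_p(y)^2 is unchanged modulo
p^(s+1) by shifts of y by multiples of p. -/
theorem padicGamma_sq_mul_congr_natCast (hp : p ≠ 2) {s : ℕ} (hs : 1 ≤ s) (y t : ℤ_[p])
    (ht : (p : ℤ_[p]) ^ s ∣ t) (j : ℕ) :
    (p : ℤ_[p]) ^ (s + 1) ∣ padicGamma p (y + t + ((p * j : ℕ) : ℤ_[p])) ^ 2 * padicGamma p y ^ 2 -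
      padicGamma p (y + ((p * j : ℕ) : ℤ_[p])) ^ 2 * padicGamma p (y + t) ^ 2 := by
  induction j with
  | zero => simp [mul_comm]
  | succ j ih =>
    have e : ∀ z : ℤ_[p], z + ((p * (j + 1) : ℕ) : ℤ_[p]) = z + ((p * j : ℕ) : ℤ_[p]) +
        (p : ℤ_[p]) :=
      fun z => by push_cast; ring
    have hc := prod_unitOrOne_sq_congr hs (y + ((p * j : ℕ) : ℤ_[p])) t ht
    rw [e, e, padicGamma_add_natCast hp, padicGamma_add_natCast hp _ p]
    have hsign : ((-1 : ℤ_[p]) ^ p) ^ 2 = 1 := by rw [← pow_mul, mul_comm, pow_mul]; simp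
    rw [show y + ((p * j : ℕ) : ℤ_[p]) + t = y + t + ((p * j : ℕ) : ℤ_[p]) by ring] at hc
    rw [mul_pow, mul_pow, mul_pow, mul_pow, hsign, one_mul, one_mul]
    rw [← toZModPow_eq_toZModPow_iff] at *
    rw [map_mul, map_mul] at ih
    rw [map_mul, map_mul, map_mul, map_mul, hc]
    linear_combination (PadicInt.toZModPow (s + 1)
      ((∏ i ∈ Finset.range p, unitOrOne p (y + ((p * j : ℕ) : ℤ_[p]) + i)) ^ 2)) * ih

/-- Modulo p^(s+1), shifting both arguments by t preserves the ratio of Γ_p(y)^2 to Γ_p(y - t)^2.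
The shift t is replaced by a nearby natural number, which is a multiple of p because p divides t. -/
theorem padicGamma_sq_mul_congr (hp : p ≠ 2) {s : ℕ} (hs : 1 ≤ s) (y t : ℤ_[p])
    (ht : (p : ℤ_[p]) ^ s ∣ t) :
    (p : ℤ_[p]) ^ (s + 1) ∣ padicGamma p (y + t) ^ 2 * padicGamma p (y - t) ^ 2 -
      padicGamma p y ^ 4 := by
  obtain ⟨a, ha, -⟩ := exists_natCast_padicGamma hp (s + 1) t
  have hpa : p ∣ a := by
    rw [← PadicInt.natCast_dvd_natCast_iff]
    refine (dvd_iff_dvd_of_dvd_sub ((dvd_pow_self _ s.succ_ne_zero).trans ha)).1 ?_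
    exact (dvd_pow_self _ (by omega)).trans ht
  obtain ⟨j, rfl⟩ := hpa
  have h := padicGamma_sq_mul_congr_natCast hp hs (y - t) t ht j
  rw [sub_add_cancel] at h
  have h1 : (p : ℤ_[p]) ^ (s + 1) ∣
      padicGamma p (y + t) - padicGamma p (y + ((p * j : ℕ) : ℤ_[p])) :=
    padicGamma_congr hp _ (by rwa [add_sub_add_left_eq_sub])
  have h2 : (p : ℤ_[p]) ^ (s + 1) ∣
      padicGamma p y - padicGamma p (y - t + ((p * j : ℕ) : ℤ_[p])) :=
    padicGamma_congr hp _ (by convert ha using 1; ring)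
  rw [← toZModPow_eq_toZModPow_iff] at *
  simp only [map_mul, map_pow] at *
  rw [h1, h, ← h2]
  ring

end PadicGamma

/-! ### Pochhammer symbols and factorials split into p-parts and Gamma factors -/

section HalfPochhammer

variable {p : ℕ} [Fact p.Prime]

theorem PadicInt.eq_of_dvd_add_natCast {z : ℤ_[p]} {i j : ℕ} (hi : i < p) (hj : j < p)
    (h : (p : ℤ_[p]) ∣ z + i) (h' : (p : ℤ_[p]) ∣ z + j) : i = j := by
  rw [← PadicInt.zmodRepr_eq_of_dvd (x := -z) hi (by rw [← dvd_neg]; convert h using 1; ring),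
    ← PadicInt.zmodRepr_eq_of_dvd (x := -z) hj (by rw [← dvd_neg]; convert h' using 1; ring)]

theorem prod_range_prime_add (z : ℤ_[p]) (a : ℕ) (ha : a < p) (h : (p : ℤ_[p]) ∣ z + a) :
    ∏ i ∈ Finset.range p, (z + i) = (z + a) * ∏ i ∈ Finset.range p, unitOrOne p (z + i) := by
  rw [← Finset.mul_prod_erase _ _ (Finset.mem_range.2 ha),
    ← Finset.mul_prod_erase (Finset.range p) (fun i : ℕ => unitOrOne p (z + i))
      (Finset.mem_range.2 ha), unitOrOne_of_dvd h, one_mul]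
  congr 1
  refine Finset.prod_congr rfl fun i hi => ?_
  rw [Finset.mem_erase, Finset.mem_range] at hi
  rw [unitOrOne_of_not_dvd fun hd => hi.1 (PadicInt.eq_of_dvd_add_natCast hi.2 ha hd h)]

/-- Each block of p consecutive factors contains exactly one multiple of p, at offset a, and
dividing it by p leaves x' + j. Since b ≤ a, the final incomplete block contains none. -/
theorem prod_range_add_eq_pow_mul (x x' : ℤ_[p]) (a : ℕ) (ha : a < p) (h : x + a = p * x')
    (l b : ℕ) (hb : b ≤ a) :
    ∏ i ∈ Finset.range (p * l + b), (x + i) =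
      p ^ l * (∏ j ∈ Finset.range l, (x' + j)) *
        ∏ i ∈ Finset.range (p * l + b), unitOrOne p (x + i) := by
  have hd : ∀ l : ℕ, x + ((p * l : ℕ) : ℤ_[p]) + a = p * (x' + l) := fun l => by
    push_cast; linear_combination h
  have hfull : ∏ i ∈ Finset.range (p * l), (x + i) =
      p ^ l * (∏ j ∈ Finset.range l, (x' + j)) *
        ∏ i ∈ Finset.range (p * l), unitOrOne p (x + i) := by
    induction l with
    | zero => simp
    | succ l ih =>
      rw [Finset.prod_range_succ, mul_add, mul_one, Finset.prod_range_add, Finset.prod_range_add,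
        ih]
      have := prod_range_prime_add (x + ((p * l : ℕ) : ℤ_[p])) a ha (hd l ▸ dvd_mul_right _ _)
      simp only [Nat.cast_add, ← add_assoc]
      rw [this, hd]
      ring
  rw [Finset.prod_range_add, Finset.prod_range_add, hfull]
  simp only [mul_assoc]
  congr 3
  refine Finset.prod_congr rfl fun i hi => ?_
  rw [unitOrOne_of_not_dvd]
  intro hdvd
  rw [Nat.cast_add, ← add_assoc] at hdvd
  have hi := Finset.mem_range.1 hi
  have := PadicInt.eq_of_dvd_add_natCast (by omega) ha hdvd (hd l ▸ dvd_mul_right _ _)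
  omega

theorem isUnit_unitOrOne (x : ℤ_[p]) : IsUnit (unitOrOne p x) := by
  by_cases h : (p : ℤ_[p]) ∣ x
  · rw [unitOrOne_of_dvd h]; exact isUnit_one
  · rw [unitOrOne_of_not_dvd h]
    by_contra hx
    exact h ((PadicInt.norm_lt_one_iff_dvd x).1 (PadicInt.not_isUnit_iff.1 hx))

theorem natCast_factorial_eq_prod_range {R : Type*} [CommRing R] (k : ℕ) :
    (k.factorial : R) = ∏ i ∈ Finset.range k, (1 + (i : R)) := by
  rw [← Finset.prod_range_add_one_eq_factorial]
  push_cast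
  exact Finset.prod_congr rfl fun i _ => add_comm _ _

theorem factorial_eq_pow_mul_factorial_mul (N M : ℕ) (h : N / p = M) :
    ∃ u : ℤ_[p], IsUnit u ∧ (N.factorial : ℤ_[p]) = p ^ M * M.factorial * u := by
  have hP : p.Prime := Fact.out
  have hN : N = p * M + N % p := by rw [← h, Nat.div_add_mod]
  have hlt := Nat.mod_lt N hP.pos
  have hp1 : ((p - 1 : ℕ) : ℤ_[p]) = p - 1 := by rw [Nat.cast_sub hP.one_le, Nat.cast_one]
  have key := prod_range_add_eq_pow_mul (p := p) 1 1 (p - 1) (by have := hP.pos; omega)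
    (by rw [hp1]; ring) M (N % p) (by omega)
  rw [← hN, ← natCast_factorial_eq_prod_range, ← natCast_factorial_eq_prod_range] at key
  refine ⟨_, ?_, key⟩
  exact IsUnit.prod_iff.2 fun i _ => isUnit_unitOrOne _

/-- With q = 1/4 the two Gamma arguments are 1/2 + L and -L. The unit part of (1/2)_L is Γ_p(1/2 +
L)/Γ_p(1/2) up to sign, and that of L! is Γ_p(L + 1) up to sign. Then Γ_p(1/2)^2 = -1 and reflection
at L finish, the powers p^l being the same on both sides. -/
theorem sq_prod_half_mul_sq_factorial (hp : p % 4 = 1) (q : ℤ_[p]) (hq : 4 * q = 1) (l L : ℕ)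
    (hL : 4 * L + 1 = p * (4 * l + 1)) :
    (∏ i ∈ Finset.range L, (2 * q + i)) ^ 2 * (l.factorial : ℤ_[p]) ^ 2 =
      -(padicGamma p (q + p * (4 * l + 1) * q) ^ 2 * padicGamma p (q - p * (4 * l + 1) * q) ^ 2) *
        ((∏ i ∈ Finset.range l, (2 * q + i)) ^ 2 * (L.factorial : ℤ_[p]) ^ 2) := by
  have hp2 : p ≠ 2 := by omega
  obtain ⟨c, hc⟩ : ∃ c, p = 4 * c + 1 := ⟨p / 4, by omega⟩
  have hLc : L = p * l + c := by
    have : p * (4 * l + 1) = 4 * (p * l) + p := by ring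
    omega
  have hpc : (p : ℤ_[p]) = 4 * c + 1 := by exact_mod_cast congrArg (Nat.cast : ℕ → ℤ_[p]) hc
  have hL' : (4 : ℤ_[p]) * L + 1 = p * (4 * l + 1) := by exact_mod_cast hL
  have e1 : q + p * (4 * l + 1) * q = 2 * q + L := by
    rw [← hL']; linear_combination (L : ℤ_[p]) * hq
  have e2 : q - p * (4 * l + 1) * q = -L := by
    rw [← hL']; linear_combination -(L : ℤ_[p]) * hq
  -- The multiple of p sits at offset 2c = (p - 1)/2, where 1/2 + 2c = p · 1/2, so x' is again 1/2.
  have hA := prod_range_add_eq_pow_mul (2 * q) (2 * q) (2 * c) (by omega)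
    (by rw [hpc]; push_cast; linear_combination (-2 * (c : ℤ_[p])) * hq) l c (by omega)
  have hF := prod_range_add_eq_pow_mul (p := p) 1 1 (p - 1) (by omega)
    (by rw [Nat.cast_sub (by omega)]; push_cast; ring) l c (by omega)
  rw [← hLc] at hA hF
  rw [← natCast_factorial_eq_prod_range, ← natCast_factorial_eq_prod_range] at hF
  have hG1 := padicGamma_add_natCast hp2 (2 * q) L
  have hG2 := padicGamma_add_natCast hp2 (1 : ℤ_[p]) L
  have hhalf := padicGamma_half_sq hp (2 * q) (by linear_combination hq)
  have hrefl := padicGamma_reflection_sq (p := p) hp2 L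
  rw [padicGamma_one hp2] at hG2
  rw [add_comm (L : ℤ_[p])] at hrefl
  have hsign : ((-1 : ℤ_[p]) ^ L) ^ 2 = 1 := by rw [← pow_mul, mul_comm, pow_mul]; simp
  rw [e1, e2, hA, hF, hG1]
  rw [hG2] at hrefl
  generalize (∏ i ∈ Finset.range L, unitOrOne p (2 * q + i)) = W at *
  generalize (∏ i ∈ Finset.range L, unitOrOne p (1 + (i : ℤ_[p]))) = V at *
  generalize (∏ i ∈ Finset.range l, (2 * q + (i : ℤ_[p]))) = A at *
  generalize (-1 : ℤ_[p]) ^ L = e at *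
  generalize padicGamma p (2 * q) = g at *
  generalize padicGamma p (-(L : ℤ_[p])) = d at *
  generalize (l.factorial : ℤ_[p]) = f at *
  have hVd : V ^ 2 * d ^ 2 = 1 := by linear_combination hrefl - V ^ 2 * d ^ 2 * hsign
  calc _ = (p ^ l) ^ 2 * A ^ 2 * f ^ 2 * W ^ 2 := by ring
    _ = (p ^ l) ^ 2 * A ^ 2 * f ^ 2 * W ^ 2 * (e ^ 2) * (-g ^ 2) * (V ^ 2 * d ^ 2) := by
      rw [hVd, hhalf, hsign]; ring
    _ = _ := by ring

theorem PadicInt.isUnit_natCast_of_not_dvd {n : ℕ} (h : ¬ p ∣ n) : IsUnit (n : ℤ_[p]) := by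
  rw [PadicInt.isUnit_iff, PadicInt.norm_natCast_eq_one_iff]
  exact ((Nat.Prime.coprime_iff_not_dvd Fact.out).2 h)

/-- If p^v exactly divides m, then the shift pmq is divisible by p^(v+1), and evenness gives the
modulus p^(v+2), which is p^2 m up to a unit. -/
theorem sq_prime_mul_dvd_padicGamma_sub (hp : p ≠ 2) (q : ℤ_[p]) (m : ℕ) (hm : m ≠ 0) :
    (p : ℤ_[p]) ^ 2 * m ∣ padicGamma p (q + p * m * q) ^ 2 * padicGamma p (q - p * m * q) ^ 2 -
      padicGamma p q ^ 4 := by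
  obtain ⟨v, u, hu, rfl⟩ := Nat.exists_eq_pow_mul_and_not_dvd hm p (Fact.out : p.Prime).ne_one
  have hu' := PadicInt.isUnit_natCast_of_not_dvd (p := p) hu
  have e : (p : ℤ_[p]) ^ 2 * ((p ^ v * u : ℕ) : ℤ_[p]) = (p : ℤ_[p]) ^ (v + 1 + 1) * u := by
    push_cast; ring
  rw [e, hu'.mul_right_dvd]
  refine padicGamma_sq_mul_congr hp (by omega) q _ ⟨u * q, ?_⟩
  push_cast
  ring

end HalfPochhammer

theorem prod_half_add_mul_pow {K : Type*} [Field K] [CharZero K] (k : ℕ) :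
    (∏ i ∈ Finset.range k, ((1 : K) / 2 + i)) * 4 ^ k = k.centralBinom * k.factorial := by
  induction k with
  | zero => simp
  | succ k ih =>
    have h : ((k : K) + 1) * (k + 1).centralBinom = 2 * (2 * k + 1) * k.centralBinom := by
      exact_mod_cast Nat.succ_mul_centralBinom_succ k
    rw [Finset.prod_range_succ, Nat.factorial_succ, pow_succ]
    push_cast
    linear_combination (1 / 2 + (k : K)) * 4 * ih - (k.factorial : K) * h

/-! ### Interpolation at 0 and the Lagrange weights of odd squares -/

section Interpolation

open Polynomial

/-- Lagrange interpolation at `0` of a polynomial of arbitrary degree, with a remainder that is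
integral over the coefficient ring. -/
theorem Polynomial.exists_eval_zero_eq_sum_add {R K : Type*} [CommRing R] [Field K] (φ : R →+* K)
    (f : R[X]) (s : Finset ℕ) (z : ℕ → R) (hz : Set.InjOn (fun n => φ (z n)) s) :
    ∃ c : R, φ (f.eval 0) =
      ∑ n ∈ s, φ (f.eval (z n)) *
        ∏ j ∈ s.erase n, ((φ (z n) - φ (z j))⁻¹ * (0 - φ (z j))) +
      φ c * ∏ n ∈ s, (0 - φ (z n)) := by
  classical
  have hnt : Nontrivial R := φ.domain_nontrivial
  set g : R[X] := ∏ n ∈ s, (X - C (z n)) with hg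
  have hmon : g.Monic := monic_prod_of_monic _ _ fun n _ => monic_X_sub_C _
  have hdeg : g.degree = s.card := by
    rw [hg, degree_prod_of_monic _ _ fun n _ => monic_X_sub_C _]
    simp
  have hfg := modByMonic_add_div f g
  have hval : ∀ n ∈ s, (f %ₘ g).eval (z n) = f.eval (z n) := fun n hn => by
    conv_rhs => rw [← hfg]
    have hg0 : g.eval (z n) = 0 := by
      rw [hg, eval_prod]
      exact Finset.prod_eq_zero hn (by simp)
    rw [eval_add, eval_mul, hg0, zero_mul, add_zero]
  have hint : (f %ₘ g).map φ =
      Lagrange.interpolate s (fun n => φ (z n)) (fun n => φ (f.eval (z n))) := by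
    refine Lagrange.eq_interpolate_of_eval_eq _ hz ?_ fun n hn => ?_
    · exact lt_of_le_of_lt degree_map_le (hdeg ▸ degree_modByMonic_lt f hmon)
    · rw [eval_map, eval₂_at_apply, hval n hn]
  -- The nodal polynomial g is monic, so division by it stays over R. The remainder of the division
  -- is the interpolant and the quotient at 0 is the integral error coefficient.
  refine ⟨(f /ₘ g).eval 0, ?_⟩
  conv_lhs => rw [← hfg]
  rw [eval_add, eval_mul, map_add, map_mul, mul_comm (φ (g.eval 0))]
  congr 1
  · rw [← eval₂_at_apply, ← eval_map, hint, map_zero, Lagrange.interpolate_apply, eval_finsetSum]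
    refine Finset.sum_congr rfl fun n _ => ?_
    rw [eval_mul, eval_C, Lagrange.basis, eval_prod]
    congr 1
    refine Finset.prod_congr rfl fun j _ => ?_
    simp [Lagrange.basisDivisor]
  · rw [hg, eval_prod, map_prod]
    simp

theorem prod_range_two_mul_add_one (M : ℕ) :
    (∏ j ∈ Finset.range (M + 1), (2 * j + 1)) * 2 ^ M =
      (2 * M + 1) * M.centralBinom * M.factorial := by
  induction M with
  | zero => simp
  | succ M ih =>
    have h := Nat.succ_mul_centralBinom_succ M
    rw [Finset.prod_range_succ, Nat.factorial_succ, pow_succ]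
    linear_combination (2 * (M + 1) + 1) * 2 * ih - (2 * (M + 1) + 1) * M.factorial * h

theorem prod_erase_sub_mul_add (n M : ℕ) (h : n ≤ M) :
    (∏ j ∈ (Finset.range (M + 1)).erase n, ((j : ℤ) - n) * (j + n + 1)) * (2 * n + 1) =
      (-1) ^ n * (M - n).factorial * (M + n + 1).factorial := by
  induction M, h using Nat.le_induction with
  | base =>
    have h1 : ∏ j ∈ Finset.range n, ((j : ℤ) - n) = (-1) ^ n * n.factorial := by
      rw [← Nat.descFactorial_self, Nat.descFactorial_eq_prod_range]
      push_cast
      rw [← Finset.card_range n, ← Finset.prod_const, Finset.card_range,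
        ← Finset.prod_mul_distrib]
      refine Finset.prod_congr rfl fun j hj => ?_
      rw [Nat.cast_sub (Finset.mem_range.1 hj).le]
      ring
    have h2 : n.factorial * ∏ j ∈ Finset.range n, (n + 1 + j) = (n + n).factorial := by
      rw [← Nat.ascFactorial_eq_prod_range, Nat.factorial_mul_ascFactorial]
    have h2' : (n.factorial : ℤ) * ∏ j ∈ Finset.range n, ((j : ℤ) + n + 1) =
        (n + n).factorial := by
      rw [← h2]
      push_cast
      congr 1
      exact Finset.prod_congr rfl fun j _ => by ring
    rw [Finset.range_add_one, Finset.erase_insert Finset.notMem_range_self,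
      Finset.prod_mul_distrib, h1, Nat.sub_self, Nat.factorial_succ, Nat.factorial_zero]
    push_cast
    linear_combination (-1) ^ n * (2 * (n : ℤ) + 1) * h2'
  | succ M hM ih =>
    rw [Finset.range_add_one, Finset.erase_insert_of_ne (by omega), Finset.prod_insert (by simp),
      show M + 1 - n = (M - n) + 1 by omega, show M + 1 + n + 1 = (M + n + 1) + 1 by ring,
      Nat.factorial_succ, Nat.factorial_succ (M + n + 1)]
    push_cast
    rw [Nat.cast_sub hM]
    linear_combination ((M : ℤ) + 1 - n) * (M + 1 + n + 1) * ih

/-- The factor 2n + 1 gained by the values at the nodes is exactly what makes the weight integral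
away from 2, and it brings out (2M + 1) binom(2M, M), the source of the extra power of p. The scale
a cancels. -/
theorem lagrange_weight_odd_squares {K : Type*} [Field K] [CharZero K] (n M : ℕ) (h : n ≤ M)
    (a : K) (ha : a ≠ 0) :
    16 ^ M * (2 * (n : K) + 1) * ∏ j ∈ (Finset.range (M + 1)).erase n,
      (((a * (2 * (n : K) + 1)) ^ 2 - (a * (2 * (j : K) + 1)) ^ 2)⁻¹ *
        (0 - (a * (2 * (j : K) + 1)) ^ 2)) =
      (-1) ^ n * (2 * M + 1).choose (M - n) * ((2 * M + 1 : ℕ) * M.centralBinom : K) := by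
  have hm : (2 * (n : K) + 1) ≠ 0 := by exact_mod_cast (by omega : 2 * n + 1 ≠ 0)
  have hcard : ((Finset.range (M + 1)).erase n).card = M := by
    rw [Finset.card_erase_of_mem (Finset.mem_range.2 (by omega)), Finset.card_range]; rfl
  have hfac : ∏ j ∈ (Finset.range (M + 1)).erase n,
      (((a * (2 * (n : K) + 1)) ^ 2 - (a * (2 * (j : K) + 1)) ^ 2)⁻¹ *
        (0 - (a * (2 * (j : K) + 1)) ^ 2)) =
      (∏ j ∈ (Finset.range (M + 1)).erase n, (2 * (j : K) + 1)) ^ 2 /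
        (4 ^ M * ∏ j ∈ (Finset.range (M + 1)).erase n, ((j : K) - n) * (j + n + 1)) := by
    rw [← Finset.prod_pow, ← hcard, ← Finset.prod_const, hcard, ← Finset.prod_mul_distrib,
      ← Finset.prod_div_distrib]
    refine Finset.prod_congr rfl fun j hj => ?_
    have hjn : (j : K) - n ≠ 0 := sub_ne_zero.2 (by exact_mod_cast Finset.ne_of_mem_erase hj)
    have hjn' : (j : K) + n + 1 ≠ 0 := by exact_mod_cast (by omega : j + n + 1 ≠ 0)
    have e : (a * (2 * (n : K) + 1)) ^ 2 - (a * (2 * (j : K) + 1)) ^ 2 =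
        -(a ^ 2 * (4 * ((j - n) * (j + n + 1)))) := by ring
    rw [e]
    field_simp
    ring
  have hden : (∏ j ∈ (Finset.range (M + 1)).erase n, ((j : K) - n) * (j + n + 1)) *
      (2 * n + 1) = (-1) ^ n * (M - n).factorial * (M + n + 1).factorial := by
    exact_mod_cast congrArg (Int.cast : ℤ → K) (prod_erase_sub_mul_add n M h)
  have hnum : (2 * (n : K) + 1) * (∏ j ∈ (Finset.range (M + 1)).erase n, (2 * (j : K) + 1)) *
      2 ^ M = (2 * M + 1 : ℕ) * M.centralBinom * M.factorial := by
    rw [Finset.mul_prod_erase (Finset.range (M + 1)) (fun j : ℕ => 2 * (j : K) + 1)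
      (Finset.mem_range.2 (by omega))]
    exact_mod_cast congrArg (Nat.cast : ℕ → K) (prod_range_two_mul_add_one M)
  have hch : ((2 * M + 1).choose (M - n) : K) * (M - n).factorial * (M + n + 1).factorial =
      (2 * M + 1 : ℕ) * (M.centralBinom * M.factorial * M.factorial) := by
    have h1 := Nat.choose_mul_factorial_mul_factorial (show M - n ≤ 2 * M + 1 by omega)
    rw [show 2 * M + 1 - (M - n) = M + n + 1 by omega, Nat.factorial_succ (2 * M)] at h1
    have h2 := Nat.choose_mul_factorial_mul_factorial (show M ≤ 2 * M by omega)
    rw [show 2 * M - M = M by omega] at h2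
    rw [← h2] at h1
    rw [Nat.centralBinom_eq_two_mul_choose]
    exact_mod_cast h1
  have hf1 : ((M - n).factorial : K) ≠ 0 := by exact_mod_cast Nat.factorial_ne_zero _
  have hf2 : ((M + n + 1).factorial : K) ≠ 0 := by exact_mod_cast Nat.factorial_ne_zero _
  have hs : ((-1 : K) ^ n) * (-1) ^ n = 1 := by rw [← mul_pow]; simp
  have hs0 : ((-1 : K) ^ n) ≠ 0 := left_ne_zero_of_mul (hs ▸ one_ne_zero)
  have hD : (∏ j ∈ (Finset.range (M + 1)).erase n, ((j : K) - n) * (j + n + 1)) ≠ 0 := by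
    refine left_ne_zero_of_mul (b := 2 * (n : K) + 1) ?_
    rw [hden]
    exact mul_ne_zero (mul_ne_zero hs0 hf1) hf2
  rw [hfac]
  have h16 : (16 : K) ^ M = 2 ^ M * 2 ^ M * 4 ^ M := by
    rw [← mul_pow, ← mul_pow]; norm_num
  rw [h16]
  generalize (∏ j ∈ (Finset.range (M + 1)).erase n, ((j : K) - n) * (j + n + 1)) = D at *
  generalize (∏ j ∈ (Finset.range (M + 1)).erase n, (2 * (j : K) + 1)) = E at *
  generalize ((2 * M + 1 : ℕ) : K) = t at *
  generalize ((2 * M + 1).choose (M - n) : K) = c at *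
  generalize (M.centralBinom : K) = b at *
  generalize (M.factorial : K) = f at *
  generalize (-1 : K) ^ n = e at *
  generalize ((M - n).factorial : K) = f1 at *
  generalize ((M + n + 1).factorial : K) = f2 at *
  have h4 : (4 : K) ^ M ≠ 0 := pow_ne_zero _ (by norm_num)
  rw [mul_div_assoc', div_eq_iff (mul_ne_zero h4 hD)]
  refine mul_right_cancel₀ hm ?_
  linear_combination (4 : K) ^ M * ((2 * (n : K) + 1) * E * 2 ^ M + t * b * f) * hnum -
    4 ^ M * e * c * t * b * hden - 4 ^ M * c * t * b * f1 * f2 * hs - 4 ^ M * t * b * hch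

end Interpolation

theorem prod_range_const_mul {R : Type*} [CommRing R] (a : R) (k : ℕ) (g : ℕ → R) :
    ∏ i ∈ Finset.range k, a * g i = a ^ k * ∏ i ∈ Finset.range k, g i := by
  rw [Finset.prod_mul_distrib, Finset.prod_const, Finset.card_range]

/-! ### Divisibility at the nodes and transfer to 0 -/

section Supercongruence

variable {p : ℕ} [Fact p.Prime]

theorem PadicInt.coe_prod_finset (s : Finset ℕ) (g : ℕ → ℤ_[p]) :
    ((∏ i ∈ s, g i : ℤ_[p]) : ℚ_[p]) = ∏ i ∈ s, (g i : ℚ_[p]) :=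
  map_prod PadicInt.Coe.ringHom g s

open Polynomial in
-- Since (1/2)_k / k! = binom(2k, k)/4^k is p-integral, only k!^2 needs clearing, whence d^2. The
-- scale u lets S_N(p^2 Z), with u = 1, and S_M(Z), with u = p, become polynomials in the same
-- variable p^2 Z; the rescaling costs u^(2k), also covered by d^2.
theorem exists_polynomial_eval_eq_deformedSum (d h u a : ℤ_[p]) (N : ℕ)
    (hh : 2 * h = 1) (hu : u ≠ 0) (hd : ∀ k ≤ N, u ^ k * k.factorial ∣ d) :
    ∃ f : ℤ_[p][X], ∀ z : ℤ_[p], ((f.eval (u ^ 2 * z) : ℤ_[p]) : ℚ_[p]) =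
      (d : ℚ_[p]) ^ 2 * a * deformedSum N (z : ℚ_[p]) := by
  have hh' : (h : ℚ_[p]) = 1 / 2 := by
    have : (2 : ℚ_[p]) * h = 1 := by exact_mod_cast congrArg (Subtype.val) hh
    linear_combination this / 2
  have hu' : (u : ℚ_[p]) ≠ 0 := by simpa using hu
  choose! c hc using hd
  refine ⟨∑ k ∈ Finset.range (N + 1), C (a * (k.centralBinom * (h ^ 2) ^ k) * c k ^ 2) *
    ∏ i ∈ Finset.range k, (C ((u * (i + h)) ^ 2) - X), fun z => ?_⟩
  rw [eval_finsetSum, deformedSum, Finset.mul_sum, PadicInt.coe_sum]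
  refine Finset.sum_congr rfl fun k hk => ?_
  have hk' : k ≤ N := by have := Finset.mem_range.1 hk; omega
  have hdk : (d : ℚ_[p]) = u ^ k * k.factorial * c k := by
    exact_mod_cast congrArg (Subtype.val) (hc k hk')
  have hprod : ((∏ i ∈ Finset.range k, ((u * (i + h)) ^ 2 - u ^ 2 * z) : ℤ_[p]) : ℚ_[p]) =
      (u ^ k) ^ 2 * ∏ i ∈ Finset.range k, (((i : ℚ_[p]) + 1 / 2) ^ 2 - z) := by
    rw [PadicInt.coe_prod_finset, ← pow_mul, mul_comm k 2, pow_mul]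
    rw [← prod_range_const_mul]
    refine Finset.prod_congr rfl fun i _ => ?_
    push_cast
    rw [hh']
    ring
  have hb := prod_half_add_mul_pow (K := ℚ_[p]) k
  have hf : (k.factorial : ℚ_[p]) ≠ 0 := by exact_mod_cast Nat.factorial_ne_zero _
  have h4 : (4 : ℚ_[p]) ^ k * ((1 / 2) ^ 2) ^ k = 1 := by rw [← mul_pow]; norm_num
  rw [eval_mul, eval_C, eval_prod]
  simp only [eval_sub, eval_C, eval_X]
  rw [PadicInt.coe_mul, hprod, hdk]
  push_cast
  rw [hh']
  have hb' : (∏ i ∈ Finset.range k, ((1 : ℚ_[p]) / 2 + i)) =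
      k.centralBinom * ((1 / 2) ^ 2) ^ k * k.factorial := by
    linear_combination ((1 / 2) ^ 2) ^ k * hb - (∏ i ∈ Finset.range k, ((1 : ℚ_[p]) / 2 + i)) * h4
  rw [hb']
  field_simp

theorem exists_pow_mul_sum (k : ℕ) (s : Finset ℕ) (g : ℕ → ℚ_[p])
    (h : ∀ n ∈ s, ∃ c : ℤ_[p], g n = (p : ℚ_[p]) ^ k * c) :
    ∃ c : ℤ_[p], ∑ n ∈ s, g n = (p : ℚ_[p]) ^ k * c := by
  choose! c hc using h
  refine ⟨∑ n ∈ s, c n, ?_⟩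
  rw [PadicInt.coe_sum, Finset.mul_sum]
  exact Finset.sum_congr rfl hc

/-- At the interpolation nodes the two deformed sums agree up to the expected factor. -/
theorem deformedSum_sub_at_node (hp : p % 4 = 1) (q : ℤ_[p]) (hq : 4 * q = 1) (N M n : ℕ)
    (hn : n ≤ M) (hN : p * M + (p - 1) / 2 ≤ N) :
    ∃ c : ℤ_[p], deformedSum N (((p : ℚ_[p]) / 2 * (2 * n + 1)) ^ 2) +
      (padicGamma p q : ℚ_[p]) ^ 4 * deformedSum M (((1 : ℚ_[p]) / 2 * (2 * n + 1)) ^ 2) =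
      (p : ℚ_[p]) ^ 2 * (2 * n + 1) * c := by
  obtain ⟨e, he⟩ : ∃ e, p = 4 * e + 1 := ⟨p / 4, by omega⟩
  have hpn : p * n ≤ p * M := Nat.mul_le_mul_left p hn
  -- The left argument is (n' + 1/2)^2 with n' = pn + (p - 1)/2. For n = 2l this is n' = 2L, and for
  -- n = 2l + 1 it is n' = 2J + 1, where both sums vanish.
  rcases Nat.even_or_odd' n with ⟨l, rfl | rfl⟩
  · set L := p * l + e with hLdef
    have hL : 4 * L + 1 = p * (4 * l + 1) := by
      have : p * (4 * l + 1) = 4 * (p * l) + p := by ring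
      omega
    have hLN : 2 * L ≤ N := by
      have : p * (2 * l) = 2 * (p * l) := by ring
      omega
    have hLq : (4 : ℚ_[p]) * L + 1 = p * (4 * l + 1) := by
      exact_mod_cast congrArg (Nat.cast : ℕ → ℚ_[p]) hL
    have e1 : (p : ℚ_[p]) / 2 * (2 * ((2 * l : ℕ) : ℚ_[p]) + 1) =
        ((2 * L : ℕ) : ℚ_[p]) + 1 / 2 := by
      push_cast; linear_combination -hLq / 2
    have e2 : (1 : ℚ_[p]) / 2 * (2 * ((2 * l : ℕ) : ℚ_[p]) + 1) =
        ((2 * l : ℕ) : ℚ_[p]) + 1 / 2 := by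
      ring
    rw [e1, e2, deformedSum_even L N hLN, deformedSum_even l M hn]
    have hq' : (2 : ℚ_[p]) * q = 1 / 2 := by
      have : (4 : ℚ_[p]) * q = 1 := by exact_mod_cast congrArg (Subtype.val) hq
      linear_combination this / 2
    have hcast : ∀ k : ℕ, ((∏ i ∈ Finset.range k, (2 * q + i) : ℤ_[p]) : ℚ_[p]) =
        ∏ i ∈ Finset.range k, ((1 : ℚ_[p]) / 2 + i) := fun k => by
      rw [PadicInt.coe_prod_finset, ← hq']
      push_cast
      rfl
    have hfac : ∀ k : ℕ, (k.factorial : ℚ_[p]) ≠ 0 := fun k => by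
      exact_mod_cast Nat.factorial_ne_zero k
    have key := congrArg (Subtype.val : ℤ_[p] → ℚ_[p])
      (sq_prod_half_mul_sq_factorial hp q hq l L hL)
    obtain ⟨c, hc⟩ := sq_prime_mul_dvd_padicGamma_sub (p := p) (by omega) q (4 * l + 1) (by omega)
    have hc' := congrArg (Subtype.val : ℤ_[p] → ℚ_[p]) hc
    have hb := prod_half_add_mul_pow (K := ℚ_[p]) l
    rw [show (p : ℤ_[p]) * ((4 * l + 1 : ℕ) : ℤ_[p]) = p * (4 * l + 1) by push_cast; rfl] at hc'
    simp only [PadicInt.coe_mul, PadicInt.coe_neg, PadicInt.coe_pow, hcast, PadicInt.coe_sub,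
      PadicInt.coe_natCast] at key hc'
    have h4 : (4 : ℚ_[p]) ^ l * (q : ℚ_[p]) ^ l = 1 := by
      rw [← mul_pow, show (4 : ℚ_[p]) * q = 1 by linear_combination 2 * hq', one_pow]
    have hb' : (∏ i ∈ Finset.range l, ((1 : ℚ_[p]) / 2 + i)) =
        l.centralBinom * (q : ℚ_[p]) ^ l * l.factorial := by
      linear_combination (q : ℚ_[p]) ^ l * hb -
        (∏ i ∈ Finset.range l, ((1 : ℚ_[p]) / 2 + i)) * h4
    -- The second factor is the p-integral number ((1/2)_l / l!)^2 = (binom(2l, l)/4^l)^2, and c is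
    -- the quotient from the Gamma congruence.
    refine ⟨-c * (l.centralBinom * q ^ l) ^ 2, ?_⟩
    rw [hb'] at key ⊢
    have hl := hfac l
    have hLf := hfac L
    rw [div_pow, div_pow, div_add' _ _ _ (pow_ne_zero 2 hLf), div_eq_iff (pow_ne_zero 2 hLf)]
    refine mul_right_cancel₀ (pow_ne_zero 2 hl) ?_
    push_cast at hc' ⊢
    rw [← sub_eq_zero] at hc' key ⊢
    generalize (∏ i ∈ Finset.range L, ((1 : ℚ_[p]) / 2 + i)) = A at *
    field_simp
    generalize (padicGamma p (q + p * (4 * l + 1) * q) : ℚ_[p]) = g1 at *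
    generalize (padicGamma p (q - p * (4 * l + 1) * q) : ℚ_[p]) = g2 at *
    linear_combination key -
      ((l.centralBinom : ℚ_[p]) * q ^ l * l.factorial * L.factorial) ^ 2 * hc'
  · set J := p * l + 3 * e with hJdef
    have hJ : 4 * J + 3 = p * (4 * l + 3) := by
      have : p * (4 * l + 3) = 4 * (p * l) + 3 * p := by ring
      omega
    have hJN : 2 * J + 1 ≤ N := by
      have : p * (2 * l + 1) = 2 * (p * l) + p := by ring
      omega
    have hJq : (4 : ℚ_[p]) * J + 3 = p * (4 * l + 3) := by
      exact_mod_cast congrArg (Nat.cast : ℕ → ℚ_[p]) hJ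
    have e1 : (p : ℚ_[p]) / 2 * (2 * ((2 * l + 1 : ℕ) : ℚ_[p]) + 1) =
        ((2 * J + 1 : ℕ) : ℚ_[p]) + 1 / 2 := by
      push_cast; linear_combination -hJq / 2
    have e2 : (1 : ℚ_[p]) / 2 * (2 * ((2 * l + 1 : ℕ) : ℚ_[p]) + 1) =
        ((2 * l + 1 : ℕ) : ℚ_[p]) + 1 / 2 := by
      ring
    rw [e1, e2, deformedSum_odd J N hJN, deformedSum_odd l M hn]
    exact ⟨0, by simp⟩

/-- Up to units, the product is p^(M+1) (2M + 1) binom(2M, M) M!, while N! is p^M M!. This bounds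
the interpolation error after its division by N!^2. -/
theorem prod_nodes_eq (h : ℤ_[p]) (hh : 2 * h = 1) (r N M : ℕ) (hNM : N / p = M)
    (hM : p ^ r ∣ (2 * M + 1) * M.centralBinom) :
    ∃ c : ℤ_[p], ∏ n ∈ Finset.range (M + 1), (p * h * (2 * (n : ℤ_[p]) + 1)) =
      N.factorial * p ^ (r + 1) * c := by
  obtain ⟨u, hu, hNu⟩ := factorial_eq_pow_mul_factorial_mul (p := p) N M hNM
  obtain ⟨v, hv⟩ := hu.exists_right_inv
  obtain ⟨t, ht⟩ := hM
  have ht' : (2 * (M : ℤ_[p]) + 1) * M.centralBinom = p ^ r * t := by exact_mod_cast ht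
  have hodd : (∏ j ∈ Finset.range (M + 1), (2 * (j : ℤ_[p]) + 1)) * 2 ^ M =
      (2 * M + 1) * M.centralBinom * M.factorial := by
    exact_mod_cast congrArg (Nat.cast : ℕ → ℤ_[p]) (prod_range_two_mul_add_one M)
  have h2 : (2 : ℤ_[p]) ^ M * h ^ M = 1 := by rw [← mul_pow, hh, one_pow]
  refine ⟨v * h ^ (M + 1) * h ^ M * t, ?_⟩
  rw [Finset.prod_mul_distrib, Finset.prod_const, Finset.card_range, hNu, mul_pow]
  rw [ht'] at hodd
  generalize (∏ j ∈ Finset.range (M + 1), (2 * (j : ℤ_[p]) + 1)) = E at *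
  linear_combination (p : ℤ_[p]) ^ (M + 1) * h ^ (M + 1) * h ^ M * hodd -
    (p : ℤ_[p]) ^ (M + 1) * h ^ (M + 1) * E * h2 -
    (p : ℤ_[p]) ^ (M + 1) * h ^ (M + 1) * h ^ M * p ^ r * t * M.factorial * hv

theorem deformedSum_zero_congr (hp : p % 4 = 1) (q : ℤ_[p]) (hq : 4 * q = 1) (r N M : ℕ)
    (hNM : N / p = M) (hN : p * M + (p - 1) / 2 ≤ N)
    (hM : p ^ r ∣ (2 * M + 1) * M.centralBinom) :
    ∃ c : ℤ_[p], deformedSum N (0 : ℚ_[p]) + (padicGamma p q : ℚ_[p]) ^ 4 * deformedSum M 0 =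
      (p : ℚ_[p]) ^ (r + 2) * c := by
  have hP : p.Prime := Fact.out
  have hp2 : p ≠ 2 := by omega
  set h : ℤ_[p] := 2 * q with hdef
  have hh : 2 * h = 1 := by rw [hdef]; linear_combination hq
  have hq' : (4 : ℚ_[p]) * q = 1 := by exact_mod_cast congrArg (Subtype.val) hq
  have htwo : ((2 : ℤ_[p]) : ℚ_[p]) = 2 := rfl
  have hh' : (h : ℚ_[p]) = 1 / 2 := by
    rw [hdef, PadicInt.coe_mul, htwo]; linear_combination hq' / 2
  have hp0 : (p : ℚ_[p]) ≠ 0 := by exact_mod_cast hP.ne_zero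
  obtain ⟨f₁, hf₁⟩ := exists_polynomial_eval_eq_deformedSum (N.factorial : ℤ_[p]) h 1 1 N hh
    one_ne_zero (fun k hk => by
      rw [one_pow, one_mul]; exact_mod_cast Nat.cast_dvd_cast (Nat.factorial_dvd_factorial hk))
  -- N! is a unit times p^M M!, hence divisible by p^k k! for every k ≤ M: the same denominator N!^2
  -- serves both polynomials.
  obtain ⟨f₂, hf₂⟩ := exists_polynomial_eval_eq_deformedSum (N.factorial : ℤ_[p]) h p
    (padicGamma p q ^ 4) M hh (by exact_mod_cast hP.ne_zero) (fun k hk => by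
      obtain ⟨u, -, hNu⟩ := factorial_eq_pow_mul_factorial_mul (p := p) N M hNM
      rw [hNu]
      exact (mul_dvd_mul (pow_dvd_pow _ hk)
        (Nat.cast_dvd_cast (Nat.factorial_dvd_factorial hk))).mul_right _)
  have hD : (N.factorial : ℚ_[p]) ≠ 0 := by exact_mod_cast Nat.factorial_ne_zero N
  have heval : ∀ z : ℤ_[p], (((f₁ + f₂).eval (p ^ 2 * z) : ℤ_[p]) : ℚ_[p]) =
      (N.factorial : ℚ_[p]) ^ 2 * (deformedSum N ((p : ℚ_[p]) ^ 2 * z) +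
        (padicGamma p q : ℚ_[p]) ^ 4 * deformedSum M (z : ℚ_[p])) := fun z => by
    have e1 := hf₁ (p ^ 2 * z)
    rw [one_pow, one_mul] at e1
    rw [Polynomial.eval_add, PadicInt.coe_add, e1, hf₂]
    push_cast
    ring
  have hinj : Set.InjOn (fun n : ℕ => PadicInt.Coe.ringHom (p := p)
      ((p : ℤ_[p]) ^ 2 * (h * (2 * (n : ℤ_[p]) + 1)) ^ 2)) (Finset.range (M + 1)) := by
    intro m _ n _ hmn
    have hmn' : (p : ℤ_[p]) ^ 2 * (h * (2 * (m : ℤ_[p]) + 1)) ^ 2 =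
        (p : ℤ_[p]) ^ 2 * (h * (2 * (n : ℤ_[p]) + 1)) ^ 2 := Subtype.coe_injective hmn
    have h1 := mul_left_cancel₀ (pow_ne_zero 2 (by exact_mod_cast hP.ne_zero)) hmn'
    have h2 : (2 * (m : ℤ_[p]) + 1) ^ 2 = (2 * (n : ℤ_[p]) + 1) ^ 2 := by
      refine mul_left_cancel₀ (pow_ne_zero 2 (right_ne_zero_of_mul (hh ▸ one_ne_zero))) ?_
      rw [← mul_pow, ← mul_pow]
      exact h1
    have h3 : (2 * m + 1) ^ 2 = (2 * n + 1) ^ 2 := by exact_mod_cast h2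
    have h4 := Nat.pow_left_injective two_ne_zero h3
    omega
  obtain ⟨c, hc⟩ := Polynomial.exists_eval_zero_eq_sum_add (PadicInt.Coe.ringHom (p := p))
    (f₁ + f₂) (Finset.range (M + 1)) _ hinj
  obtain ⟨c', hc'⟩ := prod_nodes_eq h hh r N M hNM hM
  -- The error term is N!^2 p^(2r+2) times an integer of ℤ_p, more than the required p^(r+2).
  have hprod : ∏ n ∈ Finset.range (M + 1), (0 - PadicInt.Coe.ringHom (p := p)
      ((p : ℤ_[p]) ^ 2 * (h * (2 * (n : ℤ_[p]) + 1)) ^ 2)) =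
      (N.factorial : ℚ_[p]) ^ 2 * ((p : ℚ_[p]) ^ (r + 2) *
        ((-1) ^ (M + 1) * p ^ r * c' ^ 2 : ℤ_[p])) := by
    have e₀ : ∏ n ∈ Finset.range (M + 1), (-1) * (p * h * (2 * (n : ℤ_[p]) + 1)) ^ 2 =
        (-1) ^ (M + 1) * (N.factorial * p ^ (r + 1) * c') ^ 2 := by
      rw [prod_range_const_mul, Finset.prod_pow, hc']
    have e : ∏ n ∈ Finset.range (M + 1),
        (((-1) * (p * h * (2 * (n : ℤ_[p]) + 1)) ^ 2 : ℤ_[p]) : ℚ_[p]) =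
        (((-1) ^ (M + 1) * (N.factorial * p ^ (r + 1) * c') ^ 2 : ℤ_[p]) : ℚ_[p]) := by
      rw [← PadicInt.coe_prod_finset, e₀]
    refine (Finset.prod_congr rfl fun n _ => ?_).trans (e.trans ?_)
    · change 0 - (((p : ℤ_[p]) ^ 2 * (h * (2 * (n : ℤ_[p]) + 1)) ^ 2 : ℤ_[p]) : ℚ_[p]) = _
      push_cast
      ring
    · push_cast
      ring
  obtain ⟨t, ht⟩ := hM
  have ht' : ((2 * M + 1 : ℕ) : ℚ_[p]) * M.centralBinom = p ^ r * t := by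
    exact_mod_cast congrArg (Nat.cast : ℕ → ℚ_[p]) ht
  have h16 : (16 : ℚ_[p]) ^ M * (q ^ 2 : ℚ_[p]) ^ M = 1 := by
    rw [← mul_pow, show (16 : ℚ_[p]) * (q : ℚ_[p]) ^ 2 = 1 by
      linear_combination (4 * (q : ℚ_[p]) + 1) * hq', one_pow]
  have hsum : ∃ d : ℤ_[p], ∑ n ∈ Finset.range (M + 1),
      (deformedSum N ((p : ℚ_[p]) ^ 2 * ((h * (2 * (n : ℤ_[p]) + 1)) ^ 2 : ℤ_[p])) +
        (padicGamma p q : ℚ_[p]) ^ 4 * deformedSum M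
          (((h * (2 * (n : ℤ_[p]) + 1)) ^ 2 : ℤ_[p]) : ℚ_[p])) *
      ∏ j ∈ (Finset.range (M + 1)).erase n, ((PadicInt.Coe.ringHom (p := p)
        ((p : ℤ_[p]) ^ 2 * (h * (2 * (n : ℤ_[p]) + 1)) ^ 2) - PadicInt.Coe.ringHom (p := p)
        ((p : ℤ_[p]) ^ 2 * (h * (2 * (j : ℤ_[p]) + 1)) ^ 2))⁻¹ * (0 - PadicInt.Coe.ringHom (p := p)
        ((p : ℤ_[p]) ^ 2 * (h * (2 * (j : ℤ_[p]) + 1)) ^ 2))) = (p : ℚ_[p]) ^ (r + 2) * d := by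
    refine exists_pow_mul_sum _ _ _ fun n hn => ?_
    have hnM : n ≤ M := by have := Finset.mem_range.1 hn; omega
    obtain ⟨b, hb⟩ := deformedSum_sub_at_node hp q hq N M n hnM hN
    have hz : ∀ j : ℕ, PadicInt.Coe.ringHom (p := p)
        ((p : ℤ_[p]) ^ 2 * (h * (2 * (j : ℤ_[p]) + 1)) ^ 2) =
        ((p : ℚ_[p]) / 2 * (2 * (j : ℚ_[p]) + 1)) ^ 2 := fun j => by
      change (((p : ℤ_[p]) ^ 2 * (h * (2 * (j : ℤ_[p]) + 1)) ^ 2 : ℤ_[p]) : ℚ_[p]) = _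
      push_cast
      rw [hh', htwo]
      ring
    have hw := lagrange_weight_odd_squares n M hnM ((p : ℚ_[p]) / 2)
      (div_ne_zero hp0 two_ne_zero)
    simp only [hz]
    have e1 : (p : ℚ_[p]) ^ 2 * ((h * (2 * (n : ℤ_[p]) + 1)) ^ 2 : ℤ_[p]) =
        ((p : ℚ_[p]) / 2 * (2 * n + 1)) ^ 2 := by
      push_cast; rw [hh', htwo]; ring
    have e2 : (((h * (2 * (n : ℤ_[p]) + 1)) ^ 2 : ℤ_[p]) : ℚ_[p]) =
        ((1 : ℚ_[p]) / 2 * (2 * n + 1)) ^ 2 := by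
      push_cast; rw [hh', htwo]
    rw [e1, e2, hb]
    rw [ht'] at hw
    -- The value at the node supplies p^2 (2n + 1), the weight turns 2n + 1 into p^r t times a
    -- binomial coefficient, and (q^2)^M is the inverse of 16^M.
    refine ⟨b * (-1) ^ n * (2 * M + 1).choose (M - n) * t * (q ^ 2) ^ M, ?_⟩
    generalize (∏ j ∈ (Finset.range (M + 1)).erase n, _ : ℚ_[p]) = w at *
    push_cast at h16 ⊢
    linear_combination (p : ℚ_[p]) ^ 2 * b * ((q : ℚ_[p]) ^ 2) ^ M * hw -
      (p : ℚ_[p]) ^ 2 * (2 * n + 1) * b * w * h16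
  obtain ⟨d, hd⟩ := hsum
  refine ⟨d + c * ((-1) ^ (M + 1) * p ^ r * c' ^ 2), ?_⟩
  have h0 := heval 0
  rw [mul_zero, PadicInt.coe_zero, mul_zero] at h0
  refine mul_left_cancel₀ (pow_ne_zero 2 hD) ?_
  rw [← h0]
  change PadicInt.Coe.ringHom (p := p) ((f₁ + f₂).eval 0) = _
  have heval' : ∀ z : ℤ_[p], PadicInt.Coe.ringHom (p := p) ((f₁ + f₂).eval (p ^ 2 * z)) =
      (N.factorial : ℚ_[p]) ^ 2 * (deformedSum N ((p : ℚ_[p]) ^ 2 * z) +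
        (padicGamma p q : ℚ_[p]) ^ 4 * deformedSum M (z : ℚ_[p])) := heval
  rw [hc, hprod]
  simp only [heval', mul_assoc]
  rw [← Finset.mul_sum]
  rw [hd]
  change _ + (c : ℚ_[p]) * _ = _
  push_cast
  ring

end Supercongruence

theorem mainTheorem3 (p : ℕ) [Fact p.Prime] (hp : p ≡ 1 [MOD 4]) (r : ℕ) (hr : 1 ≤ r) :
    PadicCongr p (r + 1)
      (halfCubeSum ((p ^ r - 1) / 2) : ℚ_[p])
      (-((padicGamma p (PadicInt.inv 4) : ℚ_[p]) ^ 4) *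
        (halfCubeSum ((p ^ (r - 1) - 1) / 2) : ℚ_[p])) ∧
    PadicCongr p (r + 1)
      (halfCubeSum (p ^ r - 1) : ℚ_[p])
      (-((padicGamma p (PadicInt.inv 4) : ℚ_[p]) ^ 4) *
        (halfCubeSum (p ^ (r - 1) - 1) : ℚ_[p])) := by
  have hP : p.Prime := Fact.out
  have hp4 : p % 4 = 1 := hp
  have hp2 : p ≠ 2 := by omega
  -- From here r stands for the original r - 1, so the target modulus is p^(r+2).
  obtain ⟨r, rfl⟩ : ∃ s, r = s + 1 := ⟨r - 1, by omega⟩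
  have hq := four_mul_padicInv_four p hp2
  obtain ⟨a, ha⟩ : ∃ a, p = 2 * a + 1 := hP.odd_of_ne_two hp2
  obtain ⟨b, hb⟩ : ∃ b, p ^ r = 2 * b + 1 := (hP.odd_of_ne_two hp2).pow
  have hpb : p ^ (r + 1) = 2 * (p * b) + p := by rw [pow_succ, hb]; ring
  have hpp : p ^ (r + 1) = p * p ^ r := pow_succ' p r
  simp only [halfCubeSum_cast, PadicCongr, neg_mul, sub_neg_eq_add, Nat.add_sub_cancel]
  have hpos : 0 < p ^ r := pow_pos hP.pos r
  have hdiv : ∀ M c N : ℕ, c < p → N = p * M + c → N / p = M := fun M c N hc h => by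
    rw [h, Nat.mul_add_div hP.pos, Nat.div_eq_of_lt hc, add_zero]
  constructor
  · refine deformedSum_zero_congr hp4 _ hq r _ _ ?_ ?_ ?_
    · rw [show (p ^ r - 1) / 2 = b by omega]
      exact hdiv b a _ (by omega) (by omega)
    · rw [show (p ^ r - 1) / 2 = b by omega]
      omega
    -- For the half-length sum, 2M + 1 is p^r itself.
    · rw [show (p ^ r - 1) / 2 = b by omega, ← hb]
      exact dvd_mul_right _ _
  · obtain ⟨K, hK⟩ : ∃ K, p ^ r = K + 1 := ⟨p ^ r - 1, by omega⟩
    have hpK : p ^ (r + 1) = p * K + p := by rw [hpp, hK]; ring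
    rw [show p ^ r - 1 = K by omega]
    refine deformedSum_zero_congr hp4 _ hq r _ _ ?_ ?_ ?_
    · exact hdiv K (p - 1) _ (by omega) (by omega)
    · omega
    -- For the full-length sum M + 1 = p^r, and 2(2M + 1) binom(2M, M) = (M + 1) binom(2M + 2, M +
    -- 1); the factor 2 is prime to p.
    · have hcop : Nat.Coprime (p ^ r) 2 :=
        Nat.Coprime.pow_left _ ((Nat.coprime_primes hP Nat.prime_two).2 hp2)
      refine hcop.dvd_of_dvd_mul_left ?_
      rw [← mul_assoc, ← Nat.succ_mul_centralBinom_succ, ← hK]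
      exact dvd_mul_right _ _
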